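/- Let $A$ be a ring and $R\subseteq A$ a subring such that $A=\sigma(R)\langle x_1,\dots,x_n\rangle$ is a $\sigma$-PBW extension of $R$, i.e. $x_1,\dots,x_n\in A\setminus R$; the standard monomials $x^\alpha=x_1^{\alpha_1}\cdots x_n^{\alpha_n}$, $\alpha\in\mathbb N^n$, form a basis $\mathrm{Mon}(A)$ of $A$ as a left $R$-module; for all $i$ and all $0\ne r\in R$ there is $0\neq c_{i,r}\in R$ with $x_ir-c_{i,r}x_i\in R$; and for all $i,j$ there is $0\ne c_{i,j}\in R$ with $x_jx_i-c_{i,j}x_ix_j\in R+Rx_1+\cdots+Rx_n$. Then there are unique maps $\sigma_i,\delta_i:R\to R$ with $x_ir=\sigma_i(r)x_i+\delta_i(r)$ for all $r\in R$. Put $\sigma^\alpha=\sigma_1^{\alpha_1}\cdots\sigma_n^{\alpha_n}$, $|\alpha|=\alpha_1+\cdots+\alpha_n$, and let $c_{\alpha,\beta}\in R$ be the coefficient of $x^{\alpha+\beta}$ in $x^\alpha x^\beta$. Assume: - $A$ is quasi-commutative: the elements $c_{i,r}$, $c_{i,j}$ can be chosen non-zero with $x_ir=c_{i,r}x_i$ and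 $x_jx_i=c_{i,j}x_ix_j$; - $A$ is bijective: all $\sigma_i$ are bijective and $c_{i,j}$ is invertible in $R$ for $i<j$; - $R$ is left Noetherian (for example, $R$ is left Gröbner soluble (LGS), i.e. left Noetherian with algorithms that solve the membership problem for finitely generated left ideals and compute generators of syzygy modules). Let $\mathrm{Mon}(A)$ and $\mathrm{Mon}(A^m)=\{x^\alpha \mathbf e_i\}$, where $A^m$ is the free left $A$-module of vectors of length $m$, be endowed with monomial orders. That is, $\mathrm{Mon}(A)$ has a total order such that $x^\beta\succeq x^\alpha$ implies $lm(x^\gamma x^\beta x^\lambda)\succeq lm(x^\gamma x^\alpha x^\lambda)$, such that $x^\alpha\succeq 1$, and such that $|\beta|>|\alpha|$ implies $x^\beta\succ x^\alpha$; and $\mathrm{Mon}(A^m)$ has a total order such that $lm(x^\beta x^\alpha)\mathbf e_i\succeq x^\alpha\mathbf e_i$, such that $x^\beta\mathbf e_j\succeq x^\alpha\mathbf e_i$ implies $lm(x^\gamma x^\beta)\mathbf e_j\succeq lm(x^\gamma x^\alpha)\mathbf e_i$, and such that $|\beta|>|\alpha|$ implies $x^\beta\mathbf e_j\succ x^\alpha\mathbf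 e_i$. Here $lm$ and $lc$ denote leading monomial and leading coefficient. Then every submodule $M$ of $A^m$ has a Gröbner basis: if $M=0$ it is $\{0\}$, and if $M\neq0$ there is a non-empty finite set $G$ of non-zero vectors of $M$ such that every $0\ne \mathbf f\in M$ is reducible with respect to $G$, i.e. there are $\mathbf g_1,\dots,\mathbf g_t\in G$, $r_1,\dots,r_t\in R$ and $\alpha_1,\dots,\alpha_t\in\mathbb N^n$ such that, writing $lm(\mathbf f)=x^{\beta}\mathbf e_u$ and $lm(\mathbf g_k)=x^{\beta_k}\mathbf e_{u_k}$, one has $u_k=u$ and $\alpha_k+\beta_k=\beta$ for all $k$ and $$lc(\mathbf f)=\sum_{k=1}^t r_k\,\sigma^{\alpha_k}(lc(\mathbf g_k))\,c_{\alpha_k,\beta_k}$$ (then $\mathbf f$ reduces in one step to $\mathbf f-\sum_k r_kx^{\alpha_k}\mathbf g_k$). -/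

import Mathlib

noncomputable section

namespace SkewPBW

/-- A standard monomial `x^α = x₁^α₁ ⋯ xₙ^αₙ`, represented by its exponent vector `α ∈ ℕⁿ`.
(In a σ-PBW extension the standard monomials form a basis, so that monomials and exponent
vectors correspond bijectively.) A structure is used so that no order is inherited from `ℕⁿ`. -/
@[ext]
structure Monomial (n : ℕ) where
  /-- the exponent vector `exp(x^α) = α` -/
  exp : Fin n → ℕ

/-- `deg(x^α) = |α| = α₁ + ⋯ + αₙ`. -/
def Monomial.deg {n : ℕ} (X : Monomial n) : ℕ := ∑ i, X.exp i

/-- A monomial `X e_i` of the free module `A^m`. -/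
@[ext]
structure VMonomial (m n : ℕ) where
  /-- the index `i` -/
  ind : Fin m
  /-- the monomial `X` -/
  mon : Monomial n

/-- `deg(X e_i) = deg(X)`. -/
def VMonomial.deg {m n : ℕ} (X : VMonomial m n) : ℕ := X.mon.deg

/-- The element `x₁^α₁ ⋯ xₙ^αₙ` of `A` (ordered product). -/
def evalMonomial {A : Type*} [Ring A] {n : ℕ} (x : Fin n → A) (X : Monomial n) : A :=
  (List.ofFn fun i => x i ^ X.exp i).prod

/-- `A` is a σ-PBW extension `σ(R)⟨x₁, …, xₙ⟩` of the subring `R`. -/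
structure Extension {A : Type*} [Ring A] (R : Subring A) (n : ℕ) where
  /-- the elements `x₁, …, xₙ` -/
  x : Fin n → A
  x_notMem : ∀ i, x i ∉ R
  /-- the standard monomials are left linearly independent over `R` … -/
  linearIndependent : LinearIndependent R (evalMonomial x)
  /-- … and generate `A` as a left `R`-module -/
  span_eq_top : Submodule.span R (Set.range (evalMonomial x)) = ⊤
  /-- `x_i r - c_{i,r} x_i ∈ R` with `c_{i,r} ∈ R - {0}` -/
  exists_commute_coeff : ∀ (i : Fin n) (r : R), r ≠ 0 →
    ∃ c : R, c ≠ 0 ∧ x i * (r : A) - (c : A) * x i ∈ R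
  /-- `x_j x_i - c_{i,j} x_i x_j ∈ R + R x₁ + ⋯ + R xₙ` with `c_{i,j} ∈ R - {0}` -/
  exists_commute_var : ∀ i j : Fin n,
    ∃ c : R, c ≠ 0 ∧
      x j * x i - (c : A) * x i * x j ∈ Submodule.span R (insert (1 : A) (Set.range x))

namespace Extension

variable {A : Type*} [Ring A] {R : Subring A} {n : ℕ} (E : Extension R n)

/-- The standard monomial `x^α` as an element of `A`. -/
def monomial (X : Monomial n) : A := evalMonomial E.x X

/-- The left `R`-basis `Mon(A)` of `A`. -/
def basis : Module.Basis (Monomial n) R A :=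
  Module.Basis.mk E.linearIndependent E.span_eq_top.ge

/-- The coefficient of the standard monomial `X` in `f`. -/
def coeff (f : A) (X : Monomial n) : R := E.basis.repr f X

/-- The finite set of monomials that occur in `f` with non-zero coefficient. -/
def support (f : A) : Finset (Monomial n) := (E.basis.repr f).support

/-- The endomorphism `σ_i` of `R`: as `x_i r = σ_i(r) x_i + δ_i(r)` with `δ_i(r) ∈ R`, the element
`σ_i(r)` is the coefficient of the monomial `x_i` in `x_i r`. -/
def sigma (i : Fin n) : Function.End R :=
  fun r => E.coeff (E.x i * (r : A)) ⟨Pi.single i 1⟩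

/-- `σ^α = σ₁^α₁ ∘ ⋯ ∘ σₙ^αₙ` (multiplication in `Function.End R` is composition). -/
def sigmaPow (X : Monomial n) : Function.End R :=
  (List.ofFn fun i => E.sigma i ^ X.exp i).prod

/-- The element `c_{α,β} ∈ R` with `x^α x^β = c_{α,β} x^{α+β} + p_{α,β}`, where `p_{α,β}` has
degree `< |α+β|`: the coefficient of `x^{α+β}` in `x^α x^β`. -/
def mulCoeff (X Y : Monomial n) : R :=
  E.coeff (E.monomial X * E.monomial Y) ⟨X.exp + Y.exp⟩

/-- `A` is quasi-commutative: `x_i r = c_{i,r} x_i` and `x_j x_i = c_{i,j} x_i x_j`, with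
non-zero coefficients. -/
structure IsQuasiCommutative : Prop where
  commute_coeff : ∀ (i : Fin n) (r : R), r ≠ 0 →
    ∃ c : R, c ≠ 0 ∧ E.x i * (r : A) = (c : A) * E.x i
  commute_var : ∀ i j : Fin n,
    ∃ c : R, c ≠ 0 ∧ E.x j * E.x i = (c : A) * E.x i * E.x j

/-- `A` is bijective: every `σ_i` is bijective, and for `i < j` the (unique) coefficient `c_{i,j}`
with `x_j x_i - c_{i,j} x_i x_j ∈ R + R x₁ + ⋯ + R xₙ` is invertible in `R`. -/
structure IsBijective : Prop where
  sigma_bijective : ∀ i, Function.Bijective (E.sigma i)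
  isUnit_coeff : ∀ i j : Fin n, i < j → ∀ c : R,
    E.x j * E.x i - (c : A) * E.x i * E.x j
      ∈ Submodule.span R (insert (1 : A) (Set.range E.x)) → IsUnit c

/-- The leading monomial `lm(f)` of `f ∈ A` for a total order on `Mon(A)`. The element `⊥` of
`WithBot (Monomial n)` stands for `0`: `lm(0) = 0`, and every monomial is larger than `0`. -/
def lm [LinearOrder (Monomial n)] (f : A) : WithBot (Monomial n) := (E.support f).max

/-- A total order on `Mon(A)` is a monomial order. -/
structure IsMonomialOrder [LinearOrder (Monomial n)] : Prop where
  lm_mul_le : ∀ X Y Z W : Monomial n, X ≤ Y →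
    E.lm (E.monomial Z * E.monomial X * E.monomial W)
      ≤ E.lm (E.monomial Z * E.monomial Y * E.monomial W)
  one_le : ∀ X : Monomial n, ⟨0⟩ ≤ X
  deg_compatible : ∀ X Y : Monomial n, X.deg < Y.deg → X < Y

variable {m : ℕ}

/-- The finite set of monomials of `A^m` that occur in the vector `f`. -/
def vsupport (f : Fin m → A) : Finset (VMonomial m n) :=
  ((Finset.univ : Finset (Fin m)).sigma fun i => E.support (f i)).map
    ⟨fun p => ⟨p.1, p.2⟩, fun p q h => by
      cases p; cases q; cases h; rfl⟩

variable (m) in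
/-- A total order on `Mon(A^m)` is a monomial order (relative to the order on `Mon(A)`). Here
`(E.lm f).map (VMonomial.mk i)` is the monomial `lm(f) e_i`. -/
structure IsVMonomialOrder [LinearOrder (Monomial n)] [LinearOrder (VMonomial m n)] : Prop where
  le_lm_mul : ∀ (i : Fin m) (X Y : Monomial n),
    ((⟨i, X⟩ : VMonomial m n) : WithBot (VMonomial m n))
      ≤ (E.lm (E.monomial Y * E.monomial X)).map (VMonomial.mk i)
  lm_mul_le : ∀ (i j : Fin m) (X Y Z : Monomial n),
    (⟨i, X⟩ : VMonomial m n) ≤ ⟨j, Y⟩ →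
    (E.lm (E.monomial Z * E.monomial X)).map (VMonomial.mk i)
      ≤ (E.lm (E.monomial Z * E.monomial Y)).map (VMonomial.mk j)
  deg_compatible : ∀ X Y : VMonomial m n, X.deg < Y.deg → X < Y

section Vectors

variable [LinearOrder (VMonomial m n)]

/-- The leading monomial of a vector of `A^m`, with `⊥` in the role of `lm(0) = 0`. -/
def vlm (f : Fin m → A) : WithBot (VMonomial m n) := (E.vsupport f).max

/-- The leading coefficient of a vector of `A^m`, with `lc(0) = 0`. -/
def vlc (f : Fin m → A) : R :=
  WithBot.recBotCoe (0 : R) (fun X : VMonomial m n => E.coeff (f X.ind) X.mon) (E.vlm f)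

/-- `f` reduces to `h` by `F` in one step: there are `g_1, …, g_t ∈ F`, `r_1, …, r_t ∈ R` and
exponents `α_1, …, α_t` (with `X_k = lm(g_k)`) such that
(i) `ind(X_k) = ind(lm(f))` and `α_k + exp(X_k) = exp(lm(f))`,
(ii) `lc(f) = ∑ r_k σ^{α_k}(lc(g_k)) c_{α_k, exp(X_k)}`,
(iii) `h = f - ∑ r_k x^{α_k} g_k`.
For `f = 0` this forces `t = 0` and `h = 0`, so that `0` reduces exactly to `0`. -/
def Reduces (F : Finset (Fin m → A)) (f h : Fin m → A) : Prop :=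
  ∃ (t : ℕ) (g : Fin t → Fin m → A) (r : Fin t → R) (α : Fin t → Monomial n)
    (X : Fin t → VMonomial m n),
    (∀ k, g k ∈ F) ∧
    (∀ k, E.vlm (g k) = (X k : WithBot (VMonomial m n))) ∧
    (∀ k, ∃ Y : VMonomial m n, E.vlm f = (Y : WithBot (VMonomial m n)) ∧
      (X k).ind = Y.ind ∧ (α k).exp + (X k).mon.exp = Y.mon.exp) ∧
    E.vlc f = ∑ k, r k * E.sigmaPow (α k) (E.vlc (g k)) * E.mulCoeff (α k) (X k).mon ∧
    h = f - ∑ k, ((r k : A) * E.monomial (α k)) • g k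

/-- `f` is reducible with respect to `F`: it is not zero and has a one step reduction. -/
def IsReducible (F : Finset (Fin m → A)) (f : Fin m → A) : Prop :=
  f ≠ 0 ∧ ∃ h, E.Reduces F f h

/-- `G` is a Gröbner basis of the submodule `M` of `A^m`: for `M ≠ 0`, `G` is a non-empty finite
set of non-zero vectors of `M` with respect to which every non-zero vector of `M` is reducible;
the Gröbner basis of `0` is `{0}`. -/
def IsGroebnerBasis (M : Submodule A (Fin m → A)) (G : Finset (Fin m → A)) : Prop :=
  (M ≠ ⊥ ∧ G.Nonempty ∧ (∀ g ∈ G, g ∈ M ∧ g ≠ 0) ∧ ∀ f ∈ M, f ≠ 0 → E.IsReducible G f) ∨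
  (M = ⊥ ∧ G = {0})

end Vectors

end Extension

end SkewPBW

end

/-! Fix a position i and attach to each exponent γ the set L(γ) of all s ∈ R such that σ^γ(s) is the
coefficient of x^γ e_i in a vector of M without larger monomials. Multiplication by x^α distorts
plain leading coefficients by σ^α; pulling them back along σ^γ removes the distortion, because
σ^α(σ^β(s)) c_{α,β} = c_{α,β} σ^{α+β}(s) and c_{α,β} is a unit. Hence L(γ) is a left ideal that
grows with γ (`leadingIdeal_le`).

By Dickson's lemma and the ascending chain condition in R, finitely many β suffice: every γ has such
a β ≤ γ with L(β) = L(γ) (`OrderHom.exists_finset_le_eq`). Lifting finite generating sets of these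
L(β) to M, for all i, gives the Gröbner basis (`exists_generators`): if lc(f) = σ^γ(s), an
expression of s in the generators of L(β) is a reduction of f (`isReducible_of_mem_span`). -/

noncomputable section

/-- A monotone map from a well-quasi-order to a partial order with the ascending chain condition
has only finitely many essential values. -/
theorem OrderHom.exists_finset_le_eq {P I : Type*} [Preorder P] [WellQuasiOrderedLE P]
    [PartialOrder I] [WellFoundedGT I] (L : P →o I) :
    ∃ B : Finset P, ∀ p, ∃ b ∈ B, b ≤ p ∧ L b = L p := by
  by_contra! h
  -- A sequence in which no earlier term lies below a later one with the same value; along a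
  -- monotone subsequence the values could never stabilise.
  obtain ⟨f, -, hf⟩ := exists_seq_of_forall_finset_exists (fun _ : P => True)
    (fun b p => b ≤ p → L b ≠ L p) fun s _ => (h s).imp fun p hp => ⟨trivial, hp⟩
  obtain ⟨g, hg⟩ := (wellQuasiOrdered_le (α := P)).exists_monotone_subseq f
  obtain ⟨k, hk⟩ := WellFoundedGT.monotone_chain_condition
    (⟨fun i => L (f (g i)), fun i j hij => L.monotone (hg i j hij)⟩ : ℕ →o I)
  exact hf _ _ (g.strictMono k.lt_succ_self) (hg _ _ k.le_succ) (hk _ k.le_succ)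

/-- Ordered products of pairwise commuting families multiply termwise. -/
theorem List.prod_map_mul_of_commute {ι Q : Type*} [Monoid Q] (f g : ι → Q)
    (h : ∀ i j, Commute (f i) (g j)) (l : List ι) :
    (l.map f).prod * (l.map g).prod = (l.map fun i => f i * g i).prod := by
  induction l with
  | nil => simp
  | cons i l ih =>
    have hc : Commute (l.map f).prod (g i) :=
      Commute.list_prod_left _ _ fun a ha => by
        obtain ⟨j, -, rfl⟩ := List.mem_map.1 ha
        exact h j i
    simp only [List.map_cons, List.prod_cons, ← ih]
    rw [mul_assoc, ← mul_assoc _ (g i), hc.eq]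
    simp only [mul_assoc]

/-! ### Equality up to units of R -/

namespace Subring

variable {A : Type*} [Ring A] (R : Subring A)

/-- The elements `a` with `a Rˣ ⊆ Rˣ a`. -/
def unitNormalizer : Submonoid A where
  carrier := {a | ∀ u : Rˣ, ∃ v : Rˣ, a * ((u : R) : A) = ((v : R) : A) * a}
  one_mem' u := ⟨u, by simp⟩
  mul_mem' {a b} ha hb u := by
    obtain ⟨v, hv⟩ := hb u
    obtain ⟨w, hw⟩ := ha v
    exact ⟨w, by rw [mul_assoc, hv, ← mul_assoc, hw, mul_assoc]⟩

/-- Equality up to a unit of `R` on the left. -/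
def unitCon : Con R.unitNormalizer where
  r a b := ∃ u : Rˣ, (a : A) = ((u : R) : A) * b
  iseqv :=
    { refl a := ⟨1, by simp⟩
      symm := by
        rintro a b ⟨u, h⟩
        refine ⟨u⁻¹, ?_⟩
        rw [h, ← mul_assoc, ← Subring.coe_mul, Units.inv_mul, Subring.coe_one, one_mul]
      trans := by
        rintro a b c ⟨u, h⟩ ⟨v, h'⟩
        exact ⟨u * v, by rw [h, h', Units.val_mul, Subring.coe_mul, mul_assoc]⟩ }
  mul' := by
    rintro a b c d ⟨u, h⟩ ⟨v, h'⟩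
    obtain ⟨w, hw⟩ := b.2 v
    refine ⟨u * w, ?_⟩
    rw [Submonoid.coe_mul, Submonoid.coe_mul, h, h', Units.val_mul, Subring.coe_mul, mul_assoc,
      ← mul_assoc (b : A), hw]
    simp only [mul_assoc]

end Subring

/-! ### Coefficients in the basis of standard monomials -/

namespace SkewPBW

theorem evalMonomial_eq_prod_map {A : Type*} [Ring A] {n : ℕ} (x : Fin n → A) (X : Monomial n) :
    evalMonomial x X = ((List.finRange n).map fun i => x i ^ X.exp i).prod := by
  rw [evalMonomial, List.ofFn_eq_map]

namespace Extension

variable {A : Type*} [Ring A] {R : Subring A} {n : ℕ} (E : Extension R n)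

theorem basis_apply (X : Monomial n) : E.basis X = E.monomial X :=
  Module.Basis.mk_apply _ _ _

theorem coeff_zero (X : Monomial n) : E.coeff 0 X = 0 := by simp [coeff]

theorem coeff_add (f g : A) (X : Monomial n) : E.coeff (f + g) X = E.coeff f X + E.coeff g X := by
  simp [coeff]

theorem coeff_mul (r : R) (f : A) (X : Monomial n) :
    E.coeff ((r : A) * f) X = r * E.coeff f X := by
  rw [← smul_eq_mul (r : A) f, ← Subring.smul_def]
  simp [coeff]

theorem coeff_monomial_self (X : Monomial n) : E.coeff (E.monomial X) X = 1 := by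
  simp [coeff, ← basis_apply]

theorem coeff_monomial_of_ne {X Y : Monomial n} (h : X ≠ Y) : E.coeff (E.monomial X) Y = 0 := by
  simp [coeff, ← basis_apply, h]

theorem mem_support {f : A} {X : Monomial n} : X ∈ E.support f ↔ E.coeff f X ≠ 0 := by
  simp [support, coeff]

theorem eq_zero_of_coeff {f : A} (h : ∀ X, E.coeff f X = 0) : f = 0 :=
  E.basis.repr.map_eq_zero_iff.1 (Finsupp.ext h)

theorem mul_monomial_injective (X : Monomial n) {r s : R}
    (h : (r : A) * E.monomial X = s * E.monomial X) : r = s := by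
  simpa [coeff_mul, coeff_monomial_self] using congrArg (E.coeff · X) h

theorem monomial_single (i : Fin n) : E.monomial ⟨Pi.single i 1⟩ = E.x i := by
  rw [monomial, evalMonomial_eq_prod_map]
  rw [List.prod_map_eq_pow_single i]
  · simp [List.count_eq_one_of_mem (List.nodup_finRange n) (List.mem_finRange i)]
  · intro j hj _
    simp [hj]

/-! ### The twists σ^α and products of monomials -/

variable {E}

theorem IsQuasiCommutative.x_mul (hqc : E.IsQuasiCommutative) (i : Fin n) (r : R) :
    E.x i * (r : A) = (E.sigma i r : A) * E.x i := by
  obtain rfl | hr := eq_or_ne r 0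
  · simp [sigma, coeff_zero]
  · obtain ⟨c, -, hc⟩ := hqc.commute_coeff i r hr
    rw [sigma, hc, coeff_mul]
    nth_rw 2 [← monomial_single]
    rw [coeff_monomial_self, mul_one]

theorem IsQuasiCommutative.x_pow_mul (hqc : E.IsQuasiCommutative) (i : Fin n) (k : ℕ) (r : R) :
    E.x i ^ k * (r : A) = ((E.sigma i ^ k) r : A) * E.x i ^ k := by
  induction k generalizing r with
  | zero => simp; rfl
  | succ k ih => rw [pow_succ, mul_assoc, hqc.x_mul, ← mul_assoc, ih, mul_assoc, pow_succ]; rfl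

theorem IsQuasiCommutative.monomial_mul (hqc : E.IsQuasiCommutative) (X : Monomial n) (r : R) :
    E.monomial X * (r : A) = (E.sigmaPow X r : A) * E.monomial X := by
  rw [monomial, evalMonomial_eq_prod_map, sigmaPow, List.ofFn_eq_map]
  generalize List.finRange n = l
  induction l generalizing r with
  | nil => simp; rfl
  | cons i l ih =>
    rw [List.map_cons, List.prod_cons, mul_assoc, ih, ← mul_assoc, hqc.x_pow_mul, mul_assoc,
      List.map_cons, List.prod_cons]
    rfl

/-- `σ^α` as a ring endomorphism of `R`. -/
def IsQuasiCommutative.sigmaHom (hqc : E.IsQuasiCommutative) (X : Monomial n) : R →+* R where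
  toFun := E.sigmaPow X
  map_one' := E.mul_monomial_injective X <| by rw [← hqc.monomial_mul]; simp
  map_zero' := E.mul_monomial_injective X <| by rw [← hqc.monomial_mul]; simp
  map_add' r s := E.mul_monomial_injective X <| by
    rw [← hqc.monomial_mul, Subring.coe_add, Subring.coe_add, mul_add, add_mul,
      hqc.monomial_mul, hqc.monomial_mul]
  map_mul' r s := E.mul_monomial_injective X <| by
    rw [← hqc.monomial_mul, Subring.coe_mul, Subring.coe_mul, ← mul_assoc, hqc.monomial_mul,
      mul_assoc, hqc.monomial_mul, mul_assoc]

theorem IsQuasiCommutative.sigmaHom_apply (hqc : E.IsQuasiCommutative) (X : Monomial n) (r : R) :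
    hqc.sigmaHom X r = E.sigmaPow X r := rfl

theorem IsBijective.sigmaPow_bijective (hbij : E.IsBijective) (X : Monomial n) :
    Function.Bijective (E.sigmaPow X) := by
  rw [sigmaPow, List.ofFn_eq_map]
  generalize List.finRange n = l
  induction l with
  | nil => exact Function.bijective_id
  | cons i l ih =>
    rw [List.map_cons, List.prod_cons]
    refine Function.Bijective.comp ?_ ih
    generalize X.exp i = k
    induction k with
    | zero => exact Function.bijective_id
    | succ k ih' => rw [pow_succ]; exact ih'.comp (hbij.sigma_bijective i)

theorem IsQuasiCommutative.x_mem_unitNormalizer (hqc : E.IsQuasiCommutative) (i : Fin n) :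
    E.x i ∈ R.unitNormalizer := fun u =>
  ⟨Units.map (hqc.sigmaHom ⟨Pi.single i 1⟩ : R →* R) u, by
    rw [← monomial_single, hqc.monomial_mul]
    rfl⟩

/-- `x^α x^β` is a unit multiple of `x^{α+β}`. -/
theorem IsBijective.exists_monomial_mul_monomial (hbij : E.IsBijective)
    (hqc : E.IsQuasiCommutative) (X Y : Monomial n) :
    ∃ u : Rˣ, E.monomial X * E.monomial Y = ((u : R) : A) * E.monomial ⟨X.exp + Y.exp⟩ := by
  let x' : Fin n → R.unitNormalizer := fun i => ⟨E.x i, hqc.x_mem_unitNormalizer i⟩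
  let q : R.unitNormalizer →* R.unitCon.Quotient := R.unitCon.mk'
  let m (Z : Monomial n) : R.unitNormalizer := ((List.finRange n).map fun i => x' i ^ Z.exp i).prod
  have hm (Z : Monomial n) : (m Z : A) = E.monomial Z := by
    rw [monomial, evalMonomial_eq_prod_map]
    simp only [m, Submonoid.coe_list_prod, List.map_map]
    rfl
  -- Modulo left units the variables commute, since c_{i,j} is a unit; there the product of two
  -- monomials can be reordered freely.
  have hlt {i j : Fin n} (hij : i < j) : Commute (q (x' i)) (q (x' j)) := by
    obtain ⟨c, -, hc⟩ := hqc.commute_var i j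
    obtain ⟨u, rfl⟩ := hbij.isUnit_coeff i j hij c (by rw [hc, sub_self]; exact zero_mem _)
    refine Eq.symm ((R.unitCon.eq).2 ⟨u, ?_⟩)
    simpa [x', mul_assoc] using hc
  have hcomm (i j : Fin n) : Commute (q (x' i)) (q (x' j)) := by
    rcases lt_trichotomy i j with h | rfl | h
    · exact hlt h
    · exact Commute.refl _
    · exact (hlt h).symm
  have hq (Z : Monomial n) : q (m Z) = ((List.finRange n).map fun i => q (x' i) ^ Z.exp i).prod := by
    simp only [m, map_list_prod, List.map_map, Function.comp_def, map_pow]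
  have key : q (m X * m Y) = q (m ⟨X.exp + Y.exp⟩) := by
    rw [map_mul, hq, hq, hq, List.prod_map_mul_of_commute _ _ fun i j => (hcomm i j).pow_pow _ _]
    simp only [Pi.add_apply, pow_add]
  obtain ⟨u, hu⟩ := (R.unitCon.eq).1 key
  exact ⟨u, by simpa [hm] using hu⟩

theorem IsBijective.isUnit_mulCoeff (hbij : E.IsBijective) (hqc : E.IsQuasiCommutative)
    (X Y : Monomial n) : IsUnit (E.mulCoeff X Y) := by
  obtain ⟨u, hu⟩ := hbij.exists_monomial_mul_monomial hqc X Y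
  rw [mulCoeff, hu, coeff_mul, coeff_monomial_self, mul_one]
  exact u.isUnit

theorem IsBijective.monomial_mul_monomial (hbij : E.IsBijective) (hqc : E.IsQuasiCommutative)
    (X Y : Monomial n) : E.monomial X * E.monomial Y =
      (E.mulCoeff X Y : A) * E.monomial ⟨X.exp + Y.exp⟩ := by
  obtain ⟨u, hu⟩ := hbij.exists_monomial_mul_monomial hqc X Y
  rw [mulCoeff, hu, coeff_mul, coeff_monomial_self, mul_one]

/-- Both sides are the coefficient of x^{α+β} in x^α x^β r, by associativity. -/
theorem IsBijective.sigmaPow_sigmaPow_mul (hbij : E.IsBijective) (hqc : E.IsQuasiCommutative)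
    (X Y : Monomial n) (r : R) : E.sigmaPow X (E.sigmaPow Y r) * E.mulCoeff X Y =
      E.mulCoeff X Y * E.sigmaPow ⟨X.exp + Y.exp⟩ r := by
  apply E.mul_monomial_injective ⟨X.exp + Y.exp⟩
  rw [Subring.coe_mul, Subring.coe_mul, mul_assoc, mul_assoc, ← hqc.monomial_mul,
    ← hbij.monomial_mul_monomial hqc, ← mul_assoc, ← mul_assoc, ← hqc.monomial_mul,
    ← hbij.monomial_mul_monomial hqc, mul_assoc, mul_assoc, hqc.monomial_mul Y]

theorem monomial_induction {p : A → Prop} (f : A) (zero : p 0)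
    (add : ∀ f g, p f → p g → p (f + g)) (smul : ∀ (r : R) f, p f → p (r * f))
    (monomial : ∀ X, p (E.monomial X)) : p f := by
  have hf : f ∈ Submodule.span R (Set.range (evalMonomial E.x)) := by
    rw [E.span_eq_top]; trivial
  induction hf using Submodule.span_induction with
  | mem y hy => obtain ⟨X, rfl⟩ := hy; exact monomial X
  | zero => exact zero
  | add y z _ _ hy hz => exact add y z hy hz
  | smul r y _ hy => exact smul r y hy

/-- Left multiplication by x^α is σ^α-semilinear, so monomials suffice; there x^α x^Z is a multiple
of x^{α+Z} alone. -/
theorem IsBijective.coeff_monomial_mul (hbij : E.IsBijective) (hqc : E.IsQuasiCommutative)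
    (X Y : Monomial n) (f : A) : E.coeff (E.monomial X * f) ⟨X.exp + Y.exp⟩ =
      E.sigmaPow X (E.coeff f Y) * E.mulCoeff X Y := by
  have hz : E.sigmaPow X 0 = 0 := map_zero (hqc.sigmaHom X)
  induction f using E.monomial_induction with
  | zero => simp [coeff_zero, hz]
  | add f g hf hg =>
    rw [mul_add, coeff_add, coeff_add, hf, hg, ← add_mul]
    exact congrArg (· * _) (map_add (hqc.sigmaHom X) _ _).symm
  | smul r f hf =>
    rw [← mul_assoc, hqc.monomial_mul, mul_assoc, coeff_mul, coeff_mul, hf, ← mul_assoc]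
    exact congrArg (· * _) (map_mul (hqc.sigmaHom X) _ _).symm
  | monomial Z =>
    obtain rfl | h := eq_or_ne Z Y
    · have h1 : E.sigmaPow X 1 = 1 := map_one (hqc.sigmaHom X)
      rw [coeff_monomial_self, h1, one_mul, mulCoeff]
    · rw [hbij.monomial_mul_monomial hqc, coeff_mul, coeff_monomial_of_ne, coeff_monomial_of_ne _ h,
        hz, mul_zero, zero_mul]
      simpa [Monomial.ext_iff] using h

theorem IsBijective.exists_of_coeff_monomial_mul_ne_zero (hbij : E.IsBijective)
    (hqc : E.IsQuasiCommutative) (X W : Monomial n) (f : A)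
    (h : E.coeff (E.monomial X * f) W ≠ 0) : ∃ Y : Monomial n, W = ⟨X.exp + Y.exp⟩ := by
  contrapose! h
  induction f using E.monomial_induction with
  | zero => simp [coeff_zero]
  | add f g hf hg => rw [mul_add, coeff_add, hf, hg, add_zero]
  | smul r f hf => rw [← mul_assoc, hqc.monomial_mul, mul_assoc, coeff_mul, hf, mul_zero]
  | monomial Z =>
    rw [hbij.monomial_mul_monomial hqc, coeff_mul, coeff_monomial_of_ne _ (h Z).symm, mul_zero]

/-! ### Leading terms of vectors -/

variable {m : ℕ}

theorem mem_vsupport {f : Fin m → A} {v : VMonomial m n} :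
    v ∈ E.vsupport f ↔ E.coeff (f v.ind) v.mon ≠ 0 := by
  rw [← mem_support]
  constructor
  · intro h
    obtain ⟨⟨i, X⟩, hX, rfl⟩ := Finset.mem_map.1 h
    exact (Finset.mem_sigma.1 hX).2
  · intro h
    exact Finset.mem_map.2 ⟨⟨v.ind, v.mon⟩, Finset.mem_sigma.2 ⟨Finset.mem_univ _, h⟩, rfl⟩

theorem IsBijective.lm_monomial_mul_monomial [Nontrivial R] [LinearOrder (Monomial n)]
    (hbij : E.IsBijective) (hqc : E.IsQuasiCommutative) (X Y : Monomial n) :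
    E.lm (E.monomial X * E.monomial Y) = ((⟨X.exp + Y.exp⟩ : Monomial n) : WithBot _) := by
  have h : E.support (E.monomial X * E.monomial Y) = {⟨X.exp + Y.exp⟩} := by
    ext Z
    rw [mem_support, hbij.monomial_mul_monomial hqc, coeff_mul, Finset.mem_singleton]
    constructor
    · intro h
      by_contra hZ
      exact h (by rw [coeff_monomial_of_ne _ (Ne.symm hZ), mul_zero])
    · rintro rfl
      rw [coeff_monomial_self, mul_one]
      exact (hbij.isUnit_mulCoeff hqc X Y).ne_zero
  rw [lm, h, Finset.max_singleton]

theorem IsVMonomialOrder.add_le_add [Nontrivial R] [LinearOrder (Monomial n)]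
    [LinearOrder (VMonomial m n)] (hAm : E.IsVMonomialOrder m) (hbij : E.IsBijective)
    (hqc : E.IsQuasiCommutative) {i j : Fin m} {X Y : Monomial n} (Z : Monomial n)
    (h : (⟨i, X⟩ : VMonomial m n) ≤ ⟨j, Y⟩) :
    (⟨i, ⟨Z.exp + X.exp⟩⟩ : VMonomial m n) ≤ ⟨j, ⟨Z.exp + Y.exp⟩⟩ := by
  have := hAm.lm_mul_le i j X Y Z h
  rw [hbij.lm_monomial_mul_monomial hqc, hbij.lm_monomial_mul_monomial hqc] at this
  exact WithBot.coe_le_coe.1 this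

section Vectors

variable [LinearOrder (VMonomial m n)]

theorem vlm_eq {f : Fin m → A} {v : VMonomial m n} (hv : E.coeff (f v.ind) v.mon ≠ 0)
    (h : ∀ w, v < w → E.coeff (f w.ind) w.mon = 0) : E.vlm f = v := by
  refine le_antisymm (Finset.max_le fun w hw => WithBot.coe_le_coe.2 ?_)
    (Finset.le_max (mem_vsupport.2 hv))
  by_contra! hlt
  exact mem_vsupport.1 hw (h w hlt)

theorem vlc_eq {f : Fin m → A} {v : VMonomial m n} (h : E.vlm f = v) :
    E.vlc f = E.coeff (f v.ind) v.mon := by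
  rw [vlc, h]
  rfl

variable (E) in
theorem exists_leading {f : Fin m → A} (hf : f ≠ 0) : ∃ v : VMonomial m n,
    E.coeff (f v.ind) v.mon ≠ 0 ∧ ∀ w, v < w → E.coeff (f w.ind) w.mon = 0 := by
  have hne : (E.vsupport f).Nonempty := by
    by_contra h
    refine hf (funext fun i => E.eq_zero_of_coeff fun X => ?_)
    by_contra hX
    exact h ⟨⟨i, X⟩, mem_vsupport.2 hX⟩
  refine ⟨(E.vsupport f).max' hne, mem_vsupport.1 (Finset.max'_mem _ _), fun w hw => ?_⟩
  by_contra h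
  exact hw.not_ge (Finset.le_max' _ _ (mem_vsupport.2 h))

/-! ### Leading ideals -/

/-- The left ideal of all `s` such that `σ^α(s)` is the coefficient of `x^α e_i` in a vector of `M`
without larger monomials. -/
def IsQuasiCommutative.leadingIdeal (hqc : E.IsQuasiCommutative) (M : Submodule A (Fin m → A))
    (v : VMonomial m n) : Submodule R R where
  -- The coefficient may vanish, so that cancellation in sums does no harm.
  carrier := {s | ∃ f ∈ M, (∀ w, v < w → E.coeff (f w.ind) w.mon = 0) ∧
    E.coeff (f v.ind) v.mon = hqc.sigmaHom v.mon s}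
  zero_mem' := ⟨0, zero_mem _, by simp [coeff_zero], by simp [coeff_zero]⟩
  add_mem' := by
    rintro s t ⟨f, hf, hf', hs⟩ ⟨g, hg, hg', ht⟩
    refine ⟨f + g, add_mem hf hg, fun w hw => ?_, ?_⟩
    · rw [Pi.add_apply, coeff_add, hf' w hw, hg' w hw, add_zero]
    · rw [Pi.add_apply, coeff_add, hs, ht, map_add]
  smul_mem' := by
    rintro r s ⟨f, hf, hf', hs⟩
    refine ⟨(hqc.sigmaHom v.mon r : A) • f, M.smul_mem _ hf, fun w hw => ?_, ?_⟩
    · rw [Pi.smul_apply, smul_eq_mul, coeff_mul, hf' w hw, mul_zero]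
    · rw [Pi.smul_apply, smul_eq_mul, coeff_mul, hs, ← map_mul, smul_eq_mul]

/-- If f realises s at x^β e_i, then x^α f realises it at x^{α+β} e_i up to the unit c_{α,β}. -/
theorem IsVMonomialOrder.leadingIdeal_le [Nontrivial R] [LinearOrder (Monomial n)]
    (hAm : E.IsVMonomialOrder m) (hbij : E.IsBijective) (hqc : E.IsQuasiCommutative)
    (M : Submodule A (Fin m → A)) (i : Fin m) (X Y : Monomial n) :
    hqc.leadingIdeal M ⟨i, Y⟩ ≤ hqc.leadingIdeal M ⟨i, ⟨X.exp + Y.exp⟩⟩ := by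
  rintro s ⟨f, hf, hf', hs⟩
  dsimp only at hs
  obtain ⟨u, hu⟩ := hbij.isUnit_mulCoeff hqc X Y
  obtain ⟨c, hc⟩ := (hbij.sigmaPow_bijective ⟨X.exp + Y.exp⟩).2 (↑u⁻¹ : R)
  have hmem : E.monomial X • f ∈ M := M.smul_mem _ hf
  have hzero (w : VMonomial m n) (hw : ⟨i, ⟨X.exp + Y.exp⟩⟩ < w) :
      E.coeff (E.monomial X * f w.ind) w.mon = 0 := by
    by_contra hne
    obtain ⟨Z, hZ⟩ := hbij.exists_of_coeff_monomial_mul_ne_zero hqc _ _ _ hne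
    obtain ⟨j, W⟩ := w
    dsimp only at hZ hne
    subst hZ
    rw [hbij.coeff_monomial_mul hqc] at hne
    refine hne ?_
    have hlt : (⟨i, Y⟩ : VMonomial m n) < ⟨j, Z⟩ := by
      by_contra! hle
      exact hw.not_ge (hAm.add_le_add hbij hqc X hle)
    have h0 : E.coeff (f j) Z = 0 := hf' _ hlt
    rw [h0, ← hqc.sigmaHom_apply, map_zero, zero_mul]
  -- The vector x^α f has coefficient u σ^{α+β}(s) = σ^{α+β}(d s), so it witnesses d s; the left
  -- inverse c of d then recovers s.
  obtain ⟨d, hd⟩ := (hbij.sigmaPow_bijective ⟨X.exp + Y.exp⟩).2 (u : R)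
  have hcd : c * d = 1 := by
    refine (hbij.sigmaPow_bijective ⟨X.exp + Y.exp⟩).1 ?_
    change hqc.sigmaHom _ (c * d) = hqc.sigmaHom _ 1
    rw [map_mul, map_one, hqc.sigmaHom_apply, hqc.sigmaHom_apply, hc, hd, Units.inv_mul]
  have hds : d * s ∈ hqc.leadingIdeal M ⟨i, ⟨X.exp + Y.exp⟩⟩ := by
    refine ⟨_, hmem, hzero, ?_⟩
    rw [map_mul, hqc.sigmaHom_apply, hqc.sigmaHom_apply, hd, hu,
      ← hbij.sigmaPow_sigmaPow_mul hqc, ← hqc.sigmaHom_apply Y, ← hs]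
    exact hbij.coeff_monomial_mul hqc X Y (f i)
  simpa [← mul_assoc, hcd] using Submodule.smul_mem _ c hds

theorem IsVMonomialOrder.exists_finset_leadingIdeal_eq [IsNoetherianRing R] [Nontrivial R]
    [LinearOrder (Monomial n)] (hAm : E.IsVMonomialOrder m) (hbij : E.IsBijective)
    (hqc : E.IsQuasiCommutative) (M : Submodule A (Fin m → A)) (i : Fin m) :
    ∃ B : Finset (Fin n → ℕ), ∀ γ, ∃ β ∈ B, β ≤ γ ∧
      hqc.leadingIdeal M ⟨i, ⟨β⟩⟩ = hqc.leadingIdeal M ⟨i, ⟨γ⟩⟩ := by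
  refine OrderHom.exists_finset_le_eq (P := Fin n → ℕ)
    ⟨fun γ => hqc.leadingIdeal M ⟨i, ⟨γ⟩⟩, fun β γ h => ?_⟩
  have := hAm.leadingIdeal_le hbij hqc M i ⟨γ - β⟩ ⟨β⟩
  rwa [tsub_add_cancel_of_le h] at this

/-- Nonzero generators of a leading ideal lift to vectors of `M` with the given leading monomial. -/
theorem IsQuasiCommutative.exists_generators [IsNoetherianRing R] (hqc : E.IsQuasiCommutative)
    (hbij : E.IsBijective) (M : Submodule A (Fin m → A)) (v : VMonomial m n) :
    ∃ G : Finset (Fin m → A), (∀ g ∈ G, g ∈ M ∧ g ≠ 0 ∧ E.vlm g = v) ∧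
      ∀ s ∈ hqc.leadingIdeal M v,
        s ∈ Submodule.span R {t | ∃ g ∈ G, E.vlc g = E.sigmaPow v.mon t} := by
  classical
  obtain ⟨S, hS⟩ := IsNoetherian.noetherian (hqc.leadingIdeal M v)
  have hmem (s : R) (hs : s ∈ S) : s ∈ hqc.leadingIdeal M v :=
    hS ▸ Submodule.subset_span hs
  choose! g hgM hg0 hgs using hmem
  have hlm (s : R) (hs : s ∈ S) (h0 : s ≠ 0) : E.coeff (g s v.ind) v.mon ≠ 0 := by
    rw [hgs s hs]
    exact fun h => h0 <| (hbij.sigmaPow_bijective v.mon).1 <|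
      h.trans (map_zero (hqc.sigmaHom v.mon)).symm
  -- A lift of the generator 0 need not have leading monomial v, and may be zero.
  refine ⟨(S.erase 0).image g, fun f hf => ?_, fun s hs => ?_⟩
  · obtain ⟨s, hs, rfl⟩ := Finset.mem_image.1 hf
    obtain ⟨h0, hs⟩ := Finset.mem_erase.1 hs
    refine ⟨hgM s hs, fun h => hlm s hs h0 ?_, vlm_eq (hlm s hs h0) (hg0 s hs)⟩
    rw [h, Pi.zero_apply, coeff_zero]
  · rw [← hS] at hs
    refine Submodule.span_le.2 (fun t ht => ?_) hs
    obtain rfl | h0 := eq_or_ne t 0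
    · exact zero_mem _
    · refine Submodule.subset_span ⟨g t, Finset.mem_image_of_mem _ (Finset.mem_erase.2 ⟨h0, ht⟩), ?_⟩
      rw [vlc_eq (vlm_eq (hlm t ht h0) (hg0 t ht)), hgs t ht]
      rfl

/-- Applying σ^γ to s = ∑ a_k b_k gives lc(f). Since lc(g_k) = σ^β(b_k), the term of g_k in a
reduction is r_k c_{γ-β,β} σ^γ(b_k), so r_k = σ^γ(a_k) c_{γ-β,β}⁻¹ is the right choice. -/
theorem IsBijective.isReducible_of_mem_span (hbij : E.IsBijective) (hqc : E.IsQuasiCommutative)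
    {G : Finset (Fin m → A)} {f : Fin m → A} {i : Fin m} {β γ : Fin n → ℕ} (hβγ : β ≤ γ)
    (hf0 : f ≠ 0) (hf : E.vlm f = (⟨i, ⟨γ⟩⟩ : VMonomial m n)) {s : R}
    (hs : E.vlc f = E.sigmaPow ⟨γ⟩ s)
    (hspan : s ∈ Submodule.span R {t | ∃ g ∈ G,
      E.vlm g = (⟨i, ⟨β⟩⟩ : VMonomial m n) ∧ E.vlc g = E.sigmaPow ⟨β⟩ t}) :
    E.IsReducible G f := by
  obtain ⟨t, a, b, hab⟩ := Submodule.mem_span_set'.1 hspan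
  choose g hgG hglm hglc using fun k => (b k).2
  have hγ : (⟨γ - β⟩ : Monomial n).exp + (⟨β⟩ : Monomial n).exp = γ := tsub_add_cancel_of_le hβγ
  obtain ⟨u, hu⟩ := hbij.isUnit_mulCoeff hqc ⟨γ - β⟩ ⟨β⟩
  refine ⟨hf0, _, t, g, fun k => E.sigmaPow ⟨γ⟩ (a k) * (↑u⁻¹ : R), fun _ => ⟨γ - β⟩,
    fun _ => ⟨i, ⟨β⟩⟩, hgG, hglm, fun k => ⟨_, hf, rfl, hγ⟩, ?_, rfl⟩
  rw [hs, ← hab, ← hqc.sigmaHom_apply, map_sum]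
  refine Finset.sum_congr rfl fun k _ => ?_
  rw [hglc k, mul_assoc, hbij.sigmaPow_sigmaPow_mul hqc, hγ, ← hu, mul_assoc, ← mul_assoc (↑u⁻¹ : R),
    Units.inv_mul, one_mul, smul_eq_mul, map_mul]
  rfl

end Vectors

end Extension

end SkewPBW

end

/-! ### Assembling the Gröbner basis -/

theorem corollary32 {A : Type*} [Ring A] (R : Subring A) [IsNoetherianRing R] {n m : ℕ}
    (E : SkewPBW.Extension R n) (hqc : E.IsQuasiCommutative) (hbij : E.IsBijective)
    [LinearOrder (SkewPBW.Monomial n)] (hA : E.IsMonomialOrder)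
    [LinearOrder (SkewPBW.VMonomial m n)] (hAm : E.IsVMonomialOrder m)
    (M : Submodule A (Fin m → A)) :
    ∃ G : Finset (Fin m → A), E.IsGroebnerBasis M G := by
  classical
  obtain rfl | hM := eq_or_ne M ⊥
  · exact ⟨{0}, Or.inr ⟨rfl, rfl⟩⟩
  obtain ⟨f₀, hf₀, hne⟩ := (Submodule.ne_bot_iff M).1 hM
  have : Nontrivial A := by
    by_contra h
    rw [not_nontrivial_iff_subsingleton] at h
    exact hne (Subsingleton.elim _ _)
  choose B hB using hAm.exists_finset_leadingIdeal_eq hbij hqc M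
  choose G hG hspan using hqc.exists_generators hbij M
  let F : Finset (Fin m → A) :=
    Finset.univ.biUnion fun i => (B i).biUnion fun β => G ⟨i, ⟨β⟩⟩
  have hF {g : Fin m → A} : g ∈ F ↔ ∃ i, ∃ β ∈ B i, g ∈ G ⟨i, ⟨β⟩⟩ := by simp [F]
  have hred (f : Fin m → A) (hf : f ∈ M) (hf0 : f ≠ 0) : E.IsReducible F f := by
    obtain ⟨⟨i, ⟨γ⟩⟩, hv, hv'⟩ := E.exists_leading hf0
    have hlm := SkewPBW.Extension.vlm_eq hv hv'
    obtain ⟨s, hs⟩ := (hbij.sigmaPow_bijective ⟨γ⟩).2 (E.coeff (f i) ⟨γ⟩)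
    obtain ⟨β, hβ, hβγ, heq⟩ := hB i γ
    have hmem : s ∈ hqc.leadingIdeal M ⟨i, ⟨β⟩⟩ := heq ▸ ⟨f, hf, hv', hs.symm⟩
    refine hbij.isReducible_of_mem_span hqc hβγ hf0 hlm
      ((SkewPBW.Extension.vlc_eq hlm).trans hs.symm) (Submodule.span_mono ?_ (hspan _ s hmem))
    rintro t ⟨g, hg, ht⟩
    exact ⟨g, hF.2 ⟨i, β, hβ, hg⟩, (hG _ g hg).2.2, ht⟩
  refine ⟨F, Or.inl ⟨hM, ?_, fun g hg => ?_, hred⟩⟩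
  -- With an empty F the reduction of f₀ would be an empty sum, forcing lc(f₀) = 0.
  · obtain ⟨-, h, t, g, r, α, X, hg, -, -, hlc, -⟩ := hred f₀ hf₀ hne
    by_contra hempty
    have : IsEmpty (Fin t) := ⟨fun k => hempty ⟨g k, hg k⟩⟩
    obtain ⟨v, hv, hv'⟩ := E.exists_leading hne
    rw [SkewPBW.Extension.vlc_eq (SkewPBW.Extension.vlm_eq hv hv')] at hlc
    exact hv (by rw [hlc, Finset.univ_eq_empty, Finset.sum_empty])
  · obtain ⟨i, β, -, hg⟩ := hF.1 hg
    exact ⟨(hG _ g hg).1, (hG _ g hg).2.1⟩
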